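/- Let $X,U,Y$ be complex Hilbert spaces. A triple $(\mathcal A,\mathcal B,\mathcal C)$ of linear operators $\mathcal A:D(\mathcal A)\subset X\to X$, $\mathcal B:D(\mathcal B)\subset X\to U$, $\mathcal C:D(\mathcal A)\to Y$ with $D(\mathcal A)\subseteq D(\mathcal B)$ is a boundary control and observation system on $(X,U,Y)$ if (i) $A_0:=\mathcal A|_{D(\mathcal A)\cap\ker\mathcal B}$ generates a $C_0$-semigroup on $X$; (ii) there is $B\in\mathcal L(U,X)$ with $Bu\in D(\mathcal A)$ and $\mathcal B Bu=u$ for all $u\in U$, and $\mathcal A B\in\mathcal L(U,X)$; (iii) $\mathcal C$ is bounded from $D(A_0)$, with the graph norm, to $Y$. A classical solution on $[0,\tau]$ with input $u\in C^2([0,\tau];U)$ is a pair $x\in C^1([0,\tau];X)$, $y\in C([0,\tau];Y)$ with $x(t)\in D(\mathcal A)$, $\dot x(t)=\mathcal A x(t)$, $u(t)=\mathcal B x(t)$ and $y(t)=\mathcal C x(t)$ for all $t\in[0,\tau]$. The system is well-posed if there are $\tau,m>0$ such that every classical solution on $[0,\tau]$ satisfies $$\|x(\tau)\|^2+\int_0^\tau\|y(s)\|^2\,ds\le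 m\Big(\|x(0)\|^2+\int_0^\tau\|u(s)\|^2\,ds\Big).$$ A mild solution on $[0,\tau]$ with input $u\in L^2((0,\tau);U)$ is a pair $x\in C([0,\tau];X)$, $y\in L^2((0,\tau);Y)$ such that $(u,x,y)$ is a limit of classical solutions (with their inputs) in $L^2((0,\tau);U)\times C([0,\tau];X)\times L^2((0,\tau);Y)$. An exponential solution is a mild solution (on every $[0,\tau]$, $\tau>0$) of the form $(u,x,y)=(u_0e^{st},x_0e^{st},y_0e^{st})$ with $u_0\in U$, $x_0\in X$, $y_0\in Y$. If for every $u_0\in U$ there is an exponential solution, and its $y_0$ is unique, the map $\mathcal G(s):u_0\mapsto y_0$ is the transfer function at $s\in\mathbb C$; for a well-posed system it exists in $\mathcal L(U,Y)$ whenever $\operatorname{Re}s$ is large enough. **Lemma.** Let $(\mathcal A,\mathcal B_0,\mathcal C_0)$ and $(\mathcal A,\mathcal B_1,\mathcal C_1)$ be two well-posed boundary control and observation systems on $(X,U,Y)$ with the same operator $\mathcal A$, and let $$Q=\begin{pmatrix}Q_{11}&Q_{12}\\Q_{21}&Q_{22}\end{pmatrix}\in\mathcal L(U\times Y)$$ be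 such that $$Q\begin{pmatrix}\mathcal B_0x\\\mathcal C_0x\end{pmatrix}=\begin{pmatrix}\mathcal B_1x\\\mathcal C_1x\end{pmatrix},\qquad x\in D(\mathcal A).$$ Let $\mathcal G_0$ be the transfer function of $(\mathcal A,\mathcal B_0,\mathcal C_0)$ and assume $\lim_{\operatorname{Re}s\to\infty}\mathcal G_0(s)=0$ in the norm of $\mathcal L(U,Y)$. If $Q$ is invertible in $\mathcal L(U\times Y)$, then $Q_{11}$ is invertible in $\mathcal L(U)$. -/

import Mathlib

open Filter Topology MeasureTheory
open scoped NNReal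

/-- A `C₀`-semigroup (strongly continuous one-parameter semigroup) of bounded linear operators
on a complex normed space. -/
structure C0Semigroup (X : Type*) [NormedAddCommGroup X] [NormedSpace ℂ X] where
  /-- the operators `T(t)`, `t ≥ 0` -/
  T : ℝ≥0 → X →L[ℂ] X
  map_zero : T 0 = ContinuousLinearMap.id ℂ X
  map_add : ∀ s t : ℝ≥0, T (s + t) = (T s).comp (T t)
  strongly_continuous : ∀ x : X, Tendsto (fun t : ℝ≥0 => T t x) (𝓝 0) (𝓝 x)

/-- `A` is the infinitesimal generator of the semigroup `S`: `x ∈ D(A)` with `A x = z` exactly when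
`(T(t) x - x) / t → z` as `t ↓ 0`. -/
def C0Semigroup.IsGenerator {X : Type*} [NormedAddCommGroup X] [NormedSpace ℂ X]
    (S : C0Semigroup X) (A : X →ₗ.[ℂ] X) : Prop :=
  ∀ x z : X, (x, z) ∈ A.graph ↔
    Tendsto (fun t : ℝ≥0 => (t : ℝ)⁻¹ • (S.T t x - x)) (𝓝[>] 0) (𝓝 z)

namespace BCO

section

variable {X U Y : Type*}
  [NormedAddCommGroup X] [InnerProductSpace ℂ X]
  [NormedAddCommGroup U] [InnerProductSpace ℂ U]
  [NormedAddCommGroup Y] [InnerProductSpace ℂ Y]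

/-- The kernel of a partially defined operator, as a subspace of the ambient space. -/
def kernel (ℬ : X →ₗ.[ℂ] U) : Submodule ℂ X :=
  (LinearMap.ker ℬ.toFun).map ℬ.domain.subtype

/-- The operator `A₀`: the restriction of `𝒜` to `D(A₀) = D(𝒜) ∩ ker ℬ`. -/
def mainOperator (𝒜 : X →ₗ.[ℂ] X) (ℬ : X →ₗ.[ℂ] U) : X →ₗ.[ℂ] X :=
  𝒜.domRestrict (kernel ℬ)

/-- `(𝒜, ℬ, 𝒞)` is a boundary control and observation system on `(X, U, Y)`
(`𝒜` and `ℬ` carry their own domains, the domain of `𝒞` is `D(𝒜)`). -/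
structure IsSystem (𝒜 : X →ₗ.[ℂ] X) (ℬ : X →ₗ.[ℂ] U) (𝒞 : 𝒜.domain →ₗ[ℂ] Y) : Prop where
  domain_le : 𝒜.domain ≤ ℬ.domain
  generates : ∃ S : C0Semigroup X, S.IsGenerator (mainOperator 𝒜 ℬ)
  /-- a bounded right inverse `B` of `ℬ` with range in `D(𝒜)` and `𝒜 B` (here `AB`) bounded -/
  right_inverse : ∃ B AB : U →L[ℂ] X, ∀ u : U, (B u, AB u) ∈ 𝒜.graph ∧ (B u, u) ∈ ℬ.graph
  /-- `𝒞` is bounded on `D(A₀)` with the graph norm -/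
  output_bounded : ∃ c : ℝ, ∀ x : 𝒜.domain, (x : X) ∈ (mainOperator 𝒜 ℬ).domain →
    ‖𝒞 x‖ ≤ c * (‖(x : X)‖ + ‖𝒜 x‖)

/-- `(x, y)` is a classical solution on `[0, τ]` for the input `u`:
`u ∈ C²([0, τ]; U)`, `x ∈ C¹([0, τ]; X)`, `y ∈ C([0, τ]; Y)` and, for all `t ∈ [0, τ]`,
`x(t) ∈ D(𝒜)`, `x'(t) = 𝒜 x(t)`, `u(t) = ℬ x(t)`, `y(t) = 𝒞 x(t)`. The initial state is `x 0`. -/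
structure IsClassicalSolution (𝒜 : X →ₗ.[ℂ] X) (ℬ : X →ₗ.[ℂ] U) (𝒞 : 𝒜.domain →ₗ[ℂ] Y)
    (τ : ℝ) (u : ℝ → U) (x : ℝ → X) (y : ℝ → Y) : Prop where
  contDiffOn_input : ContDiffOn ℝ 2 u (Set.Icc 0 τ)
  contDiffOn_state : ContDiffOn ℝ 1 x (Set.Icc 0 τ)
  continuousOn_output : ContinuousOn y (Set.Icc 0 τ)
  state_eq : ∀ t ∈ Set.Icc 0 τ, ∃ z : X, (x t, z) ∈ 𝒜.graph ∧
    HasDerivWithinAt x z (Set.Icc 0 τ) t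
  input_eq : ∀ t ∈ Set.Icc 0 τ, (x t, u t) ∈ ℬ.graph
  output_eq : ∀ t ∈ Set.Icc 0 τ, ∃ h : x t ∈ 𝒜.domain, y t = 𝒞 ⟨x t, h⟩

/-- Well-posedness: for some `τ, m > 0`, every classical solution satisfies
`‖x(τ)‖² + ∫₀^τ ‖y‖² ≤ m (‖x(0)‖² + ∫₀^τ ‖u‖²)`. -/
def IsWellPosed (𝒜 : X →ₗ.[ℂ] X) (ℬ : X →ₗ.[ℂ] U) (𝒞 : 𝒜.domain →ₗ[ℂ] Y) : Prop :=
  ∃ τ m : ℝ, 0 < τ ∧ 0 < m ∧ ∀ (u : ℝ → U) (x : ℝ → X) (y : ℝ → Y),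
    IsClassicalSolution 𝒜 ℬ 𝒞 τ u x y →
      ‖x τ‖ ^ 2 + ∫ s in (0 : ℝ)..τ, ‖y s‖ ^ 2 ≤
        m * (‖x 0‖ ^ 2 + ∫ s in (0 : ℝ)..τ, ‖u s‖ ^ 2)

/-- `(x, y)` is a mild solution on `[0, τ]` for the input `u`: `u` and `y` are square integrable,
`x` is continuous, and `(u, x, y)` is the limit of classical solutions
in `L²((0, τ); U) × C([0, τ]; X) × L²((0, τ); Y)`. -/
structure IsMildSolution (𝒜 : X →ₗ.[ℂ] X) (ℬ : X →ₗ.[ℂ] U) (𝒞 : 𝒜.domain →ₗ[ℂ] Y)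
    (τ : ℝ) (u : ℝ → U) (x : ℝ → X) (y : ℝ → Y) : Prop where
  memLp_input : MemLp u 2 (volume.restrict (Set.Icc 0 τ))
  continuousOn_state : ContinuousOn x (Set.Icc 0 τ)
  memLp_output : MemLp y 2 (volume.restrict (Set.Icc 0 τ))
  approx : ∃ (un : ℕ → ℝ → U) (xn : ℕ → ℝ → X) (yn : ℕ → ℝ → Y),
    (∀ n, IsClassicalSolution 𝒜 ℬ 𝒞 τ (un n) (xn n) (yn n)) ∧
    Tendsto (fun n => eLpNorm (un n - u) 2 (volume.restrict (Set.Icc 0 τ))) atTop (𝓝 0) ∧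
    TendstoUniformlyOn xn x atTop (Set.Icc 0 τ) ∧
    Tendsto (fun n => eLpNorm (yn n - y) 2 (volume.restrict (Set.Icc 0 τ))) atTop (𝓝 0)

/-- `(u₀ e^{st}, x₀ e^{st}, y₀ e^{st})`, `t ≥ 0`, is an exponential solution. -/
def IsExponentialSolution (𝒜 : X →ₗ.[ℂ] X) (ℬ : X →ₗ.[ℂ] U) (𝒞 : 𝒜.domain →ₗ[ℂ] Y)
    (s : ℂ) (u₀ : U) (x₀ : X) (y₀ : Y) : Prop :=
  ∀ τ : ℝ, 0 < τ → IsMildSolution 𝒜 ℬ 𝒞 τ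
    (fun t : ℝ => Complex.exp (s * t) • u₀)
    (fun t : ℝ => Complex.exp (s * t) • x₀)
    (fun t : ℝ => Complex.exp (s * t) • y₀)

/-- `G` is the transfer function at `s`: for every `u₀` there is an exponential solution, its
output amplitude `y₀` is unique, and `G` is the map `u₀ ↦ y₀`. -/
def IsTransferFunctionAt (𝒜 : X →ₗ.[ℂ] X) (ℬ : X →ₗ.[ℂ] U) (𝒞 : 𝒜.domain →ₗ[ℂ] Y)
    (s : ℂ) (G : U →L[ℂ] Y) : Prop :=
  ∀ (u₀ : U) (y₀ : Y), (∃ x₀ : X, IsExponentialSolution 𝒜 ℬ 𝒞 s u₀ x₀ y₀) ↔ y₀ = G u₀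

theorem IsTransferFunctionAt.unique {𝒜 : X →ₗ.[ℂ] X} {ℬ : X →ₗ.[ℂ] U} {𝒞 : 𝒜.domain →ₗ[ℂ] Y}
    {s : ℂ} {G G' : U →L[ℂ] Y} (h : IsTransferFunctionAt 𝒜 ℬ 𝒞 s G)
    (h' : IsTransferFunctionAt 𝒜 ℬ 𝒞 s G') : G = G' := by
  ext u₀
  exact (h' u₀ (G u₀)).1 ((h u₀ (G u₀)).2 rfl)

open Classical in
/-- The transfer function `s ↦ 𝒢(s) ∈ ℒ(U, Y)`, extended by `0` to those `s` at which the
transfer function does not exist. -/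
noncomputable def transferFunction (𝒜 : X →ₗ.[ℂ] X) (ℬ : X →ₗ.[ℂ] U) (𝒞 : 𝒜.domain →ₗ[ℂ] Y)
    (s : ℂ) : U →L[ℂ] Y :=
  if h : ∃ G : U →L[ℂ] Y, IsTransferFunctionAt 𝒜 ℬ 𝒞 s G then h.choose else 0

/-- The block operator `(u, y) ↦ (Q₁₁ u + Q₁₂ y, Q₂₁ u + Q₂₂ y)` in `ℒ(U × Y)`. -/
def blockOperator (Q₁₁ : U →L[ℂ] U) (Q₁₂ : Y →L[ℂ] U) (Q₂₁ : U →L[ℂ] Y) (Q₂₂ : Y →L[ℂ] Y) :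
    (U × Y) →L[ℂ] (U × Y) :=
  (Q₁₁.coprod Q₁₂).prod (Q₂₁.coprod Q₂₂)

end

end BCO

/-! Eigenvectors `𝒜 x = s x` with `s` real and large carry the argument. Both systems share `𝒜`, so
such an `x` gives amplitudes `(u₀, y₀)` and `(u₁, y₁)` for the two systems, related by `Q`. With `y₀
= 𝒢₀(s) u₀` this reads `u₁ = (Q₁₁ + Q₁₂ 𝒢₀(s)) u₀`.

This operator is onto, since each `u₁` comes from an eigenvector
(`IsSystem.eventually_exists_eigenvector`, from the resolvent of `A₀`). It is bounded below
uniformly in `s`: `(u₀, y₀) = Q⁻¹ (u₁, y₁)`, and well-posedness of the second system bounds `y₁` by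
`u₁` (`IsWellPosed.exists_norm_output_le`). As `𝒢₀(s) → 0`, `Q₁₁` is a small perturbation of an
operator whose inverse has a bound independent of `s`, and a Neumann series inverts it. -/

namespace C0Semigroup

/-! ### Semigroup orbits and the resolvent of the generator. -/

variable {X : Type*} [NormedAddCommGroup X] [NormedSpace ℂ X] (S : C0Semigroup X)

theorem norm_T_nsmul_le {M : ℝ} {t : ℝ≥0} (ht : ‖S.T t‖ ≤ M) (hM : 1 ≤ M) (n : ℕ) :
    ‖S.T (n • t)‖ ≤ M ^ n := by
  induction n with
  | zero =>
    rw [zero_smul, S.map_zero, pow_zero]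
    exact ContinuousLinearMap.norm_id_le
  | succ n ih =>
    rw [succ_nsmul, S.map_add, pow_succ]
    exact (ContinuousLinearMap.opNorm_comp_le _ _).trans
      (mul_le_mul ih ht (norm_nonneg _) (by positivity))

/-- Otherwise `‖T(tₙ)‖` is unbounded along some `tₙ → 0`, while every orbit converges along `tₙ`,
against Banach–Steinhaus. -/
theorem exists_norm_T_le_near_zero [CompleteSpace X] :
    ∃ M : ℝ, ∃ δ : ℝ≥0, 0 < δ ∧ ∀ t ≤ δ, ‖S.T t‖ ≤ M := by
  by_contra! h
  have hpos : ∀ n : ℕ, (0 : ℝ≥0) < ((n : ℝ≥0) + 1)⁻¹ := fun n => by positivity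
  choose t ht htn using fun n : ℕ => h n _ (hpos n)
  have ht0 : Tendsto t atTop (𝓝 0) := by
    refine tendsto_of_tendsto_of_tendsto_of_le_of_le tendsto_const_nhds ?_ (fun _ => zero_le) ht
    have := tendsto_one_div_add_atTop_nhds_zero_nat (𝕜 := ℝ≥0)
    simpa only [one_div] using this
  obtain ⟨C, hC⟩ := banach_steinhaus (g := fun n => S.T (t n)) fun x => by
    have hb := ((S.strongly_continuous x).comp ht0).norm.bddAbove_range
    obtain ⟨C, hC⟩ := hb
    exact ⟨C, fun n => hC ⟨n, rfl⟩⟩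
  obtain ⟨n, hn⟩ := exists_nat_gt C
  exact absurd (htn n) (not_lt.2 ((hC n).trans hn.le))

theorem exists_norm_T_le [CompleteSpace X] (K : ℝ≥0) :
    ∃ M : ℝ, ∀ t ≤ K, ‖S.T t‖ ≤ M := by
  obtain ⟨M, δ, hδ, hM⟩ := S.exists_norm_T_le_near_zero
  obtain ⟨n, hn⟩ := exists_nat_gt (K / δ)
  have hn0 : 0 < (n : ℝ≥0) := lt_of_le_of_lt zero_le hn
  refine ⟨(max M 1) ^ n, fun t ht => ?_⟩
  have hle : t / n ≤ δ := by
    rw [div_le_iff₀ hn0, mul_comm]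
    exact ht.trans ((div_lt_iff₀ hδ).1 hn).le
  have h := S.norm_T_nsmul_le ((hM _ hle).trans (le_max_left M 1)) (le_max_right M 1) n
  rwa [nsmul_eq_mul, mul_div_cancel₀ _ hn0.ne'] at h

theorem continuous_orbit [CompleteSpace X] (x : X) : Continuous fun t => S.T t x := by
  rw [continuous_iff_continuousAt]
  intro t₀
  obtain ⟨M, hM⟩ := S.exists_norm_T_le t₀
  have key : ∀ s t : ℝ≥0, s ≤ t → s ≤ t₀ → ‖S.T t x - S.T s x‖ ≤ M * ‖S.T (t - s) x - x‖ := by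
    intro s t hst hs
    have h : S.T t x = S.T s (S.T (t - s) x) := by
      rw [← ContinuousLinearMap.comp_apply, ← S.map_add, add_tsub_cancel_of_le hst]
    rw [h, ← map_sub]
    exact (S.T s).le_of_opNorm_le (hM s hs) _
  -- Subtraction in `ℝ≥0` is truncated, so this sum is `|t - t₀|`; it covers both one-sided limits.
  have hd : Tendsto (fun t : ℝ≥0 => (t - t₀) + (t₀ - t)) (𝓝 t₀) (𝓝 0) := by
    have hc : Continuous fun t : ℝ≥0 => (t - t₀) + (t₀ - t) := by fun_prop
    simpa using hc.tendsto t₀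
  have hlim : Tendsto (fun t : ℝ≥0 => M * ‖S.T ((t - t₀) + (t₀ - t)) x - x‖) (𝓝 t₀) (𝓝 0) := by
    simpa using ((((S.strongly_continuous x).comp hd).sub_const x).norm).const_mul M
  rw [ContinuousAt, tendsto_iff_norm_sub_tendsto_zero]
  refine squeeze_zero (fun _ => norm_nonneg _) (fun t => ?_) hlim
  rcases le_total t₀ t with h | h
  · rw [tsub_eq_zero_of_le h, add_zero]
    exact key _ _ h le_rfl
  · rw [tsub_eq_zero_of_le h, zero_add, norm_sub_rev]
    exact key _ _ h h

/-- The truncated Laplace transform of an orbit lies in the domain of the generator. -/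
theorem IsGenerator.integral_mem_graph [CompleteSpace X] {S : C0Semigroup X} {A : X →ₗ.[ℂ] X}
    (hA : S.IsGenerator A) (s : ℝ) (f : X) :
    ((∫ t in (0 : ℝ)..1, Real.exp (-s * t) • S.T t.toNNReal f),
      s • (∫ t in (0 : ℝ)..1, Real.exp (-s * t) • S.T t.toNNReal f)
        + (Real.exp (-s) • S.T 1 f - f)) ∈ A.graph := by
  set φ : ℝ → X := fun t => Real.exp (-s * t) • S.T t.toNNReal f with hφ
  have hcont : Continuous φ :=
    (by fun_prop : Continuous fun t : ℝ => Real.exp (-s * t)).smul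
      ((S.continuous_orbit f).comp continuous_real_toNNReal)
  set F : ℝ → X := fun r => ∫ t in (0 : ℝ)..r, φ t with hF
  have hFd : ∀ r, HasDerivAt F (φ r) r := fun r => hcont.integral_hasStrictDerivAt 0 r |>.hasDerivAt
  have hF0 : F 0 = 0 := by simp [hF]
  have hφ0 : φ 0 = f := by simp [hφ, S.map_zero]
  have hφ1 : φ 1 = Real.exp (-s) • S.T 1 f := by simp [hφ]
  -- Applying `T(h)` only moves the integration window, so the difference quotient defining the
  -- generator becomes that of a differentiable function of `h`.
  have hshift : ∀ h : ℝ≥0,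
      S.T h (F 1) = Real.exp (s * h) • (F (1 + h) - F h) := by
    intro h
    have hi : ∀ a b, IntervalIntegrable φ volume a b := fun a b => hcont.intervalIntegrable a b
    rw [hF, ← ContinuousLinearMap.intervalIntegral_comp_comm (S.T h) (hi 0 1)]
    simp only
    rw [intervalIntegral.integral_interval_sub_left (hi _ _) (hi _ _), add_comm (1 : ℝ)]
    have := intervalIntegral.integral_comp_add_left (a := 0) (b := 1) φ (h : ℝ)
    rw [add_zero] at this
    rw [← this, ← intervalIntegral.integral_smul]
    refine intervalIntegral.integral_congr fun t ht => ?_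
    rw [Set.uIcc_of_le zero_le_one] at ht
    have e : (h + t : ℝ).toNNReal = h + t.toNNReal := by
      rw [Real.toNNReal_add h.coe_nonneg ht.1, Real.toNNReal_coe]
    simp only [hφ]
    rw [e, S.map_add, smul_smul, ← Real.exp_add, ContinuousLinearMap.map_smul_of_tower,
      ContinuousLinearMap.comp_apply]
    congr 2
    ring
  have hg : HasDerivAt (fun h : ℝ => Real.exp (s * h) • (F (1 + h) - F h))
      (s • F 1 + (φ 1 - φ 0)) 0 := by
    have h1 : HasDerivAt (fun h : ℝ => Real.exp (s * h)) s 0 := by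
      simpa using ((hasDerivAt_id (0 : ℝ)).const_mul s).exp
    have h2 : HasDerivAt (fun h : ℝ => F (1 + h)) (φ 1) 0 := by
      have := hFd (1 + 0)
      rw [add_zero] at this
      exact HasDerivAt.comp_const_add 1 0 (by rwa [add_zero])
    have h3 := h1.smul (h2.sub (hFd 0))
    simp only [mul_zero, Real.exp_zero, one_smul, Pi.sub_apply, add_zero, hF0, sub_zero] at h3
    rw [add_comm]
    exact h3
  rw [hφ0, hφ1] at hg
  refine (hA _ _).2 ?_
  have ht := hg.tendsto_slope_zero_right
  have hmap : Tendsto (fun t : ℝ≥0 => (t : ℝ)) (𝓝[>] 0) (𝓝[>] 0) := by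
    refine tendsto_nhdsWithin_iff.2 ⟨?_, ?_⟩
    · exact (NNReal.continuous_coe.tendsto' 0 0 rfl).mono_left nhdsWithin_le_nhds
    · filter_upwards [self_mem_nhdsWithin] with t ht using NNReal.coe_pos.2 ht
  refine (ht.comp hmap).congr fun t => ?_
  simp only [Function.comp_apply, zero_add, mul_zero, Real.exp_zero, one_smul, add_zero,
    hF0, sub_zero]
  rw [← hshift]

/-- All sufficiently large reals have a surjective resolvent operator. -/
theorem IsGenerator.eventually_surjective [CompleteSpace X] {S : C0Semigroup X} {A : X →ₗ.[ℂ] X}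
    (hA : S.IsGenerator A) :
    ∀ᶠ s : ℝ in atTop, ∀ f : X, ∃ z w : X, (z, w) ∈ A.graph ∧ s • z - w = f := by
  -- Integrating over `[0, 1]` only leaves the defect `1 - e^{-s} T(1)`, which is invertible once
  -- `e^{-s} ‖T(1)‖ < 1`. Transforming its preimage `g` of `f` solves the resolvent equation.
  have hlim : Tendsto (fun s : ℝ => Real.exp (-s) * ‖S.T 1‖) atTop (𝓝 0) := by
    simpa using (Real.tendsto_exp_neg_atTop_nhds_zero).mul_const ‖S.T 1‖
  filter_upwards [hlim.eventually_lt_const zero_lt_one] with s hs f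
  have hn : ‖Real.exp (-s) • S.T 1‖ < 1 := by
    rwa [norm_smul, Real.norm_of_nonneg (Real.exp_pos _).le]
  set V := Units.oneSub (Real.exp (-s) • S.T 1) hn
  have hV : ∀ g, (V : X →L[ℂ] X) g = g - Real.exp (-s) • S.T 1 g := fun g => by
    simp [V]
  set g := (↑V⁻¹ : X →L[ℂ] X) f
  have hg : g - Real.exp (-s) • S.T 1 g = f := by
    rw [← hV, ← mul_apply_eq_comp, Units.mul_inv, one_apply_eq_self]
  refine ⟨_, _, hA.integral_mem_graph s g, ?_⟩
  rw [sub_add_eq_sub_sub, sub_self, zero_sub, neg_sub, hg]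

end C0Semigroup

/-! ### Convergence of squared norms in `L²`. -/

theorem MeasureTheory.MemLp.eLpNorm_two_toReal_sq {α E : Type*} [MeasurableSpace α]
    [NormedAddCommGroup E] {μ : Measure α} {f : α → E} (hf : MemLp f 2 μ) :
    (eLpNorm f 2 μ).toReal ^ 2 = ∫ a, ‖f a‖ ^ 2 ∂μ := by
  have h0 : 0 ≤ ∫ a, ‖f a‖ ^ 2 ∂μ := integral_nonneg fun a => by positivity
  rw [hf.eLpNorm_eq_integral_rpow_norm two_ne_zero ENNReal.ofNat_ne_top]
  simp only [ENNReal.toReal_ofNat, Real.rpow_two]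
  rw [ENNReal.toReal_ofReal (by positivity), ← Real.rpow_natCast, ← Real.rpow_mul h0]
  norm_num

theorem tendsto_integral_norm_sq_of_eLpNorm_sub {α E : Type*} [MeasurableSpace α]
    [NormedAddCommGroup E] {μ : Measure α} {fn : ℕ → α → E} {f : α → E}
    (hfn : ∀ n, MemLp (fn n) 2 μ) (hf : MemLp f 2 μ)
    (h : Tendsto (fun n => eLpNorm (fn n - f) 2 μ) atTop (𝓝 0)) :
    Tendsto (fun n => ∫ a, ‖fn n a‖ ^ 2 ∂μ) atTop (𝓝 (∫ a, ‖f a‖ ^ 2 ∂μ)) := by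
  have h1 := ((Lp.tendsto_Lp_iff_tendsto_eLpNorm'' fn hfn f hf).2 h).norm.pow 2
  simpa only [Lp.norm_toLp, (hfn _).eLpNorm_two_toReal_sq, hf.eLpNorm_two_toReal_sq] using h1

theorem ContinuousOn.memLp_two_Icc {E : Type*} [NormedAddCommGroup E] {f : ℝ → E} {a b : ℝ}
    (hf : ContinuousOn f (Set.Icc a b)) : MemLp f 2 (volume.restrict (Set.Icc a b)) := by
  obtain ⟨C, hC⟩ := isCompact_Icc.exists_bound_of_continuousOn hf
  exact MemLp.of_bound (hf.aestronglyMeasurable measurableSet_Icc) C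
    ((ae_restrict_iff' measurableSet_Icc).2 (.of_forall hC))

theorem intervalIntegral_eq_setIntegral_Icc {E : Type*} [NormedAddCommGroup E] [NormedSpace ℝ E]
    (f : ℝ → E) {a b : ℝ} (hab : a ≤ b) :
    ∫ t in a..b, f t = ∫ t in Set.Icc a b, f t := by
  rw [intervalIntegral.integral_of_le hab, integral_Icc_eq_integral_Ioc]

/-! ### Classical, mild and exponential solutions. -/

namespace BCO

variable {X U Y : Type*}
  [NormedAddCommGroup X] [InnerProductSpace ℂ X]
  [NormedAddCommGroup U] [InnerProductSpace ℂ U]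
  [NormedAddCommGroup Y] [InnerProductSpace ℂ Y]
  {𝒜 : X →ₗ.[ℂ] X} {ℬ : X →ₗ.[ℂ] U} {𝒞 : 𝒜.domain →ₗ[ℂ] Y} {τ : ℝ}
  {u u' : ℝ → U} {x x' : ℝ → X} {y y' : ℝ → Y}

theorem IsClassicalSolution.sub (h : IsClassicalSolution 𝒜 ℬ 𝒞 τ u x y)
    (h' : IsClassicalSolution 𝒜 ℬ 𝒞 τ u' x' y') :
    IsClassicalSolution 𝒜 ℬ 𝒞 τ (u - u') (x - x') (y - y') where
  contDiffOn_input := h.contDiffOn_input.sub h'.contDiffOn_input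
  contDiffOn_state := h.contDiffOn_state.sub h'.contDiffOn_state
  continuousOn_output := h.continuousOn_output.sub h'.continuousOn_output
  state_eq t ht := by
    obtain ⟨z, hz, hd⟩ := h.state_eq t ht
    obtain ⟨z', hz', hd'⟩ := h'.state_eq t ht
    exact ⟨z - z', 𝒜.graph.sub_mem hz hz', hd.sub hd'⟩
  input_eq t ht := ℬ.graph.sub_mem (h.input_eq t ht) (h'.input_eq t ht)
  output_eq t ht := by
    obtain ⟨hx, e⟩ := h.output_eq t ht
    obtain ⟨hx', e'⟩ := h'.output_eq t ht
    refine ⟨𝒜.domain.sub_mem hx hx', ?_⟩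
    rw [Pi.sub_apply, e, e', ← map_sub]
    rfl

theorem IsClassicalSolution.memLp_input (h : IsClassicalSolution 𝒜 ℬ 𝒞 τ u x y) :
    MemLp u 2 (volume.restrict (Set.Icc 0 τ)) :=
  h.contDiffOn_input.continuousOn.memLp_two_Icc

theorem IsClassicalSolution.memLp_output (h : IsClassicalSolution 𝒜 ℬ 𝒞 τ u x y) :
    MemLp y 2 (volume.restrict (Set.Icc 0 τ)) :=
  h.continuousOn_output.memLp_two_Icc

theorem IsClassicalSolution.isMildSolution (h : IsClassicalSolution 𝒜 ℬ 𝒞 τ u x y) :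
    IsMildSolution 𝒜 ℬ 𝒞 τ u x y where
  memLp_input := h.memLp_input
  continuousOn_state := h.contDiffOn_state.continuousOn
  memLp_output := h.memLp_output
  approx := by
    refine ⟨fun _ => u, fun _ => x, fun _ => y, fun _ => h, ?_, ?_, ?_⟩
    · simp
    · rw [Metric.tendstoUniformlyOn_iff]
      intro ε hε
      simp [hε]
    · simp

theorem tendsto_eLpNorm_sub_sub {α E : Type*} [MeasurableSpace α]
    [NormedAddCommGroup E] {μ : Measure α} {fn gn : ℕ → α → E} {f g : α → E}
    (hfn : ∀ n, MemLp (fn n) 2 μ) (hf : MemLp f 2 μ) (hgn : ∀ n, MemLp (gn n) 2 μ)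
    (hg : MemLp g 2 μ)
    (h : Tendsto (fun n => eLpNorm (fn n - f) 2 μ) atTop (𝓝 0))
    (h' : Tendsto (fun n => eLpNorm (gn n - g) 2 μ) atTop (𝓝 0)) :
    Tendsto (fun n => eLpNorm ((fn n - gn n) - (f - g)) 2 μ) atTop (𝓝 0) := by
  have h1 := ((Lp.tendsto_Lp_iff_tendsto_eLpNorm'' fn hfn f hf).2 h).sub
    ((Lp.tendsto_Lp_iff_tendsto_eLpNorm'' gn hgn g hg).2 h')
  simp only [← MemLp.toLp_sub] at h1
  exact (Lp.tendsto_Lp_iff_tendsto_eLpNorm'' _ (fun n => (hfn n).sub (hgn n)) _ (hf.sub hg)).1 h1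

theorem IsMildSolution.sub (h : IsMildSolution 𝒜 ℬ 𝒞 τ u x y)
    (h' : IsMildSolution 𝒜 ℬ 𝒞 τ u' x' y') :
    IsMildSolution 𝒜 ℬ 𝒞 τ (u - u') (x - x') (y - y') where
  memLp_input := h.memLp_input.sub h'.memLp_input
  continuousOn_state := h.continuousOn_state.sub h'.continuousOn_state
  memLp_output := h.memLp_output.sub h'.memLp_output
  approx := by
    obtain ⟨un, xn, yn, hc, hu, hx, hy⟩ := h.approx
    obtain ⟨un', xn', yn', hc', hu', hx', hy'⟩ := h'.approx
    exact ⟨fun n => un n - un' n, fun n => xn n - xn' n, fun n => yn n - yn' n,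
      fun n => (hc n).sub (hc' n),
      tendsto_eLpNorm_sub_sub (fun n => (hc n).memLp_input) h.memLp_input
        (fun n => (hc' n).memLp_input) h'.memLp_input hu hu',
      hx.sub hx',
      tendsto_eLpNorm_sub_sub (fun n => (hc n).memLp_output) h.memLp_output
        (fun n => (hc' n).memLp_output) h'.memLp_output hy hy'⟩

/-- The well-posedness estimate passes from classical to mild solutions. -/
theorem IsMildSolution.estimate {m : ℝ} (hτ : 0 ≤ τ)
    (hm : ∀ (u : ℝ → U) (x : ℝ → X) (y : ℝ → Y), IsClassicalSolution 𝒜 ℬ 𝒞 τ u x y →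
      ‖x τ‖ ^ 2 + ∫ s in (0 : ℝ)..τ, ‖y s‖ ^ 2 ≤ m * (‖x 0‖ ^ 2 + ∫ s in (0 : ℝ)..τ, ‖u s‖ ^ 2))
    (h : IsMildSolution 𝒜 ℬ 𝒞 τ u x y) :
    ‖x τ‖ ^ 2 + ∫ s in (0 : ℝ)..τ, ‖y s‖ ^ 2 ≤
      m * (‖x 0‖ ^ 2 + ∫ s in (0 : ℝ)..τ, ‖u s‖ ^ 2) := by
  simp only [intervalIntegral_eq_setIntegral_Icc _ hτ] at hm ⊢
  obtain ⟨un, xn, yn, hc, hu, hx, hy⟩ := h.approx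
  have hu' := tendsto_integral_norm_sq_of_eLpNorm_sub (fun n => (hc n).memLp_input) h.memLp_input hu
  have hy' := tendsto_integral_norm_sq_of_eLpNorm_sub (fun n => (hc n).memLp_output)
    h.memLp_output hy
  have hx0 := hx.tendsto_at (Set.left_mem_Icc.2 hτ)
  have hxτ := hx.tendsto_at (Set.right_mem_Icc.2 hτ)
  exact le_of_tendsto_of_tendsto' ((hxτ.norm.pow 2).add hy')
    (((hx0.norm.pow 2).add hu').const_mul m) fun n => hm _ _ _ (hc n)

theorem IsExponentialSolution.sub {s : ℂ} {u₀ u₁ : U} {x₀ x₁ : X} {y₀ y₁ : Y}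
    (h : IsExponentialSolution 𝒜 ℬ 𝒞 s u₀ x₀ y₀) (h' : IsExponentialSolution 𝒜 ℬ 𝒞 s u₁ x₁ y₁) :
    IsExponentialSolution 𝒜 ℬ 𝒞 s (u₀ - u₁) (x₀ - x₁) (y₀ - y₁) := by
  intro τ hτ
  simp only [smul_sub]
  exact (h τ hτ).sub (h' τ hτ)

/-- For a well-posed system, the outputs of exponential solutions are bounded by their inputs,
uniformly for large real exponents. -/
theorem IsWellPosed.exists_norm_output_le (hw : IsWellPosed 𝒜 ℬ 𝒞) :
    ∃ m : ℝ, 0 < m ∧ ∀ᶠ s : ℝ in atTop, ∀ (u₀ : U) (x₀ : X) (y₀ : Y),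
      IsExponentialSolution 𝒜 ℬ 𝒞 s u₀ x₀ y₀ → ‖y₀‖ ≤ m * ‖u₀‖ := by
  obtain ⟨τ, m, hτ, hm, hest⟩ := hw
  refine ⟨√m, Real.sqrt_pos.2 hm, ?_⟩
  have hlim : Tendsto (fun s : ℝ => Real.exp (s * τ)) atTop atTop :=
    Real.tendsto_exp_atTop.comp (tendsto_id.atTop_mul_const hτ)
  -- For `e^{sτ} ≥ max m 1` also `e^{2sτ} ≥ m`, so the final state absorbs the initial-state term of
  -- the estimate; the common factor `∫ e^{2st}` then cancels.
  filter_upwards [hlim.eventually_ge_atTop (max m 1)] with s hs u₀ x₀ y₀ h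
  have hE := (h τ hτ).estimate hτ.le hest
  simp only [norm_smul, Complex.norm_exp, mul_pow, intervalIntegral.integral_mul_const] at hE
  simp only [Complex.mul_re, Complex.ofReal_re, Complex.ofReal_im, mul_zero, sub_zero,
    Real.exp_zero, one_pow, one_mul] at hE
  set I := ∫ t in (0 : ℝ)..τ, Real.exp (s * t) ^ 2
  have hI : 0 < I := by
    refine intervalIntegral.intervalIntegral_pos_of_pos ?_ (fun t => by positivity) hτ
    exact (by fun_prop : Continuous fun t : ℝ => Real.exp (s * t) ^ 2).intervalIntegrable _ _
  have hgrow : m * ‖x₀‖ ^ 2 ≤ Real.exp (s * τ) ^ 2 * ‖x₀‖ ^ 2 := by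
    refine mul_le_mul_of_nonneg_right ?_ (by positivity)
    have h1 := (le_max_left m 1).trans hs
    have h2 := (le_max_right m 1).trans hs
    nlinarith
  have hsq : ‖y₀‖ ^ 2 ≤ m * ‖u₀‖ ^ 2 := by
    refine le_of_mul_le_mul_left ?_ hI
    linarith
  refine (sq_le_sq₀ (norm_nonneg _) (by positivity)).1 ?_
  rwa [mul_pow, Real.sq_sqrt hm.le]

/-- An eigenvector of `𝒜` yields an exponential solution. -/
theorem isExponentialSolution_of_eigenvector {s : ℂ} {x₀ : 𝒜.domain} {u₀ : U}
    (hx : 𝒜 x₀ = s • (x₀ : X)) (hu : ((x₀ : X), u₀) ∈ ℬ.graph) :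
    IsExponentialSolution 𝒜 ℬ 𝒞 s u₀ x₀ (𝒞 x₀) := by
  intro τ hτ
  have hexp : ContDiff ℝ 2 fun t : ℝ => Complex.exp (s * t) :=
    (contDiff_const.mul Complex.ofRealCLM.contDiff).cexp
  refine IsClassicalSolution.isMildSolution
    { contDiffOn_input := (hexp.smul contDiff_const).contDiffOn
      contDiffOn_state := ((hexp.of_le one_le_two).smul contDiff_const).contDiffOn
      continuousOn_output := (hexp.continuous.smul continuous_const).continuousOn
      state_eq := fun t _ => ⟨Complex.exp (s * t) • s • (x₀ : X), ?_, ?_⟩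
      input_eq := fun t _ => ℬ.graph.smul_mem _ hu
      output_eq := fun t _ => ⟨𝒜.domain.smul_mem _ x₀.2, ?_⟩ }
  · have h := 𝒜.graph.smul_mem (Complex.exp (s * t)) (𝒜.mem_graph x₀)
    rwa [hx] at h
  · have hd : HasDerivAt (fun t : ℝ => Complex.exp (s * t)) (Complex.exp (s * t) * s) t := by
      simpa using ((Complex.ofRealCLM.hasDerivAt (x := t)).const_mul s).cexp
    rw [smul_smul]
    exact (hd.smul_const (x₀ : X)).hasDerivWithinAt
  · rw [← map_smul]
    rfl

end BCO

/-- A surjective operator that is bounded below stays invertible under perturbations smaller than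
its lower bound. -/
theorem ContinuousLinearMap.isInvertible_of_surjective_add {U : Type*} [NormedAddCommGroup U]
    [NormedSpace ℂ U] [CompleteSpace U] {K R : U →L[ℂ] U} {c : ℝ} (hc : 0 < c)
    (hsurj : Function.Surjective (K + R)) (hbelow : ∀ u, ‖u‖ ≤ c * ‖(K + R) u‖)
    (hR : c * ‖R‖ < 1) : K.IsInvertible := by
  have hinj : Function.Injective (K + R) := by
    rw [injective_iff_map_eq_zero]
    intro u hu
    have := hbelow u
    rw [hu, norm_zero, mul_zero] at this
    exact norm_le_zero_iff.1 this
  let e : U ≃L[ℂ] U := ContinuousLinearEquiv.ofBijective (K + R)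
    (LinearMap.ker_eq_bot.2 hinj) (LinearMap.range_eq_top.2 hsurj)
  have he : ∀ u, e u = (K + R) u := fun u => rfl
  have hinv : ‖(e.symm : U →L[ℂ] U)‖ ≤ c := by
    refine ContinuousLinearMap.opNorm_le_bound _ hc.le fun v => ?_
    have := hbelow (e.symm v)
    rwa [← he, e.apply_symm_apply] at this
  have hn : ‖(e.symm : U →L[ℂ] U) * R‖ < 1 :=
    ((norm_mul_le _ _).trans (mul_le_mul_of_nonneg_right hinv (norm_nonneg _))).trans_lt hR
  -- Factor `K = (K + R)(1 - (K + R)⁻¹ R)`.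
  let V := ContinuousLinearEquiv.unitsEquiv ℂ U (Units.oneSub _ hn)
  refine ⟨V.trans e, ?_⟩
  ext u
  have hV : V u = u - e.symm (R u) := rfl
  change e (V u) = K u
  rw [hV, map_sub, e.apply_symm_apply, he, add_apply, add_sub_cancel_right]

/-! ### Eigenvectors of `𝒜` and the transfer function. -/

namespace BCO

variable {X U Y : Type*}
  [NormedAddCommGroup X] [InnerProductSpace ℂ X]
  [NormedAddCommGroup U] [InnerProductSpace ℂ U]
  [NormedAddCommGroup Y] [InnerProductSpace ℂ Y]
  {𝒜 : X →ₗ.[ℂ] X} {ℬ : X →ₗ.[ℂ] U} {𝒞 : 𝒜.domain →ₗ[ℂ] Y}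

theorem mem_graph_of_mem_graph_mainOperator {z w : X} (h : (z, w) ∈ (mainOperator 𝒜 ℬ).graph) :
    (z, w) ∈ 𝒜.graph ∧ (z, (0 : U)) ∈ ℬ.graph := by
  obtain ⟨⟨v, hv⟩, rfl, rfl⟩ := (LinearPMap.mem_graph_iff _).1 h
  have hv' : v ∈ kernel ℬ ∧ v ∈ 𝒜.domain := hv
  refine ⟨(LinearPMap.mem_graph_iff _).2 ⟨⟨v, hv'.2⟩, rfl, ?_⟩, ?_⟩
  · exact (LinearPMap.domRestrict_apply rfl).symm
  · obtain ⟨b, hb, hbv⟩ := hv'.1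
    exact (LinearPMap.mem_graph_iff _).2 ⟨b, hbv, hb⟩

/-- For large real `s`, every input value is attained on the eigenspace `{x | 𝒜 x = s x}`. -/
theorem IsSystem.eventually_exists_eigenvector [CompleteSpace X] (h : IsSystem 𝒜 ℬ 𝒞) :
    ∀ᶠ s : ℝ in atTop, ∀ u : U, ∃ x : 𝒜.domain,
      𝒜 x = (s : ℂ) • (x : X) ∧ ((x : X), u) ∈ ℬ.graph := by
  obtain ⟨S, hS⟩ := h.generates
  obtain ⟨B, AB, hB⟩ := h.right_inverse
  filter_upwards [hS.eventually_surjective] with s hs u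
  -- Seek `x = B u + z` with `z ∈ D(A₀)`: then `𝒜 x = s x` means `(s - A₀) z = 𝒜 B u - s B u`.
  obtain ⟨z, w, hzw, hf⟩ := hs (AB u - s • B u)
  obtain ⟨hA, hb⟩ := mem_graph_of_mem_graph_mainOperator hzw
  have hAx := 𝒜.graph.add_mem (hB u).1 hA
  have hBx := ℬ.graph.add_mem (hB u).2 hb
  obtain ⟨x, hx, hx'⟩ := (LinearPMap.mem_graph_iff _).1 hAx
  rw [Prod.mk_add_mk, add_zero] at hBx
  simp only [Prod.mk_add_mk] at hx hx'
  refine ⟨x, ?_, hx ▸ hBx⟩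
  rw [hx', hx, Complex.coe_smul, smul_add, ← sub_eq_zero]
  rw [← sub_eq_zero] at hf
  rw [← neg_eq_zero, ← hf]
  abel

/-- For large real `s` the transfer function exists and maps the input of an eigenvector to its
output. -/
theorem IsSystem.eventually_output_eq_transferFunction [CompleteSpace X] (h : IsSystem 𝒜 ℬ 𝒞)
    (hw : IsWellPosed 𝒜 ℬ 𝒞) :
    ∀ᶠ s : ℝ in atTop, ∀ (x : 𝒜.domain) (u : U), 𝒜 x = (s : ℂ) • (x : X) →
      ((x : X), u) ∈ ℬ.graph → 𝒞 x = transferFunction 𝒜 ℬ 𝒞 s u := by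
  obtain ⟨m, hm, hest⟩ := hw.exists_norm_output_le
  filter_upwards [hest, h.eventually_exists_eigenvector] with s hs hex
  choose ξ hξA hξB using hex
  have hsol : ∀ u, IsExponentialSolution 𝒜 ℬ 𝒞 s u (ξ u) (𝒞 (ξ u)) := fun u =>
    isExponentialSolution_of_eigenvector (hξA u) (hξB u)
  -- Two solutions with the same input differ by one with zero input, whose output vanishes by the
  -- estimate. Hence `𝒞 (ξ u)` is linear in `u` although `ξ` is an arbitrary choice.
  have huniq : ∀ (u : U) (x₀ : X) (y₀ : Y), IsExponentialSolution 𝒜 ℬ 𝒞 s u x₀ y₀ →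
      y₀ = 𝒞 (ξ u) := by
    intro u x₀ y₀ h'
    have := hs _ _ _ (h'.sub (hsol u))
    rw [sub_self, norm_zero, mul_zero, norm_le_zero_iff, sub_eq_zero] at this
    exact this
  have hout : ∀ (x : 𝒜.domain) (u : U), 𝒜 x = (s : ℂ) • (x : X) →
      ((x : X), u) ∈ ℬ.graph → 𝒞 x = 𝒞 (ξ u) := fun x u hx hu =>
    huniq _ _ _ (isExponentialSolution_of_eigenvector hx hu)
  let G : U →L[ℂ] Y := LinearMap.mkContinuous
    { toFun := fun u => 𝒞 (ξ u)
      map_add' := fun u v => by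
        rw [← map_add]
        refine (hout _ _ ?_ (ℬ.graph.add_mem (hξB u) (hξB v))).symm
        rw [LinearPMap.map_add, hξA, hξA, Submodule.coe_add, smul_add]
      map_smul' := fun c u => by
        rw [RingHom.id_apply, ← map_smul]
        refine (hout _ _ ?_ (ℬ.graph.smul_mem c (hξB u))).symm
        rw [LinearPMap.map_smul, hξA, Submodule.coe_smul, smul_comm] }
    m fun u => hs _ _ _ (hsol u)
  have hG : IsTransferFunctionAt 𝒜 ℬ 𝒞 s G := fun u y₀ =>
    ⟨fun ⟨x₀, h'⟩ => huniq u x₀ y₀ h', fun e => ⟨ξ u, e ▸ hsol u⟩⟩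
  have hex : ∃ G : U →L[ℂ] Y, IsTransferFunctionAt 𝒜 ℬ 𝒞 s G := ⟨G, hG⟩
  have hGs : transferFunction 𝒜 ℬ 𝒞 s = G := by
    rw [transferFunction, dif_pos hex]
    exact hex.choose_spec.unique hG
  intro x u hx hu
  rw [hGs]
  exact hout x u hx hu

end BCO

/-! ### Invertibility of `Q₁₁`. -/

theorem lemma2p12 {X U Y : Type*}
    [NormedAddCommGroup X] [InnerProductSpace ℂ X] [CompleteSpace X]
    [NormedAddCommGroup U] [InnerProductSpace ℂ U] [CompleteSpace U]
    [NormedAddCommGroup Y] [InnerProductSpace ℂ Y] [CompleteSpace Y]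
    (𝒜 : X →ₗ.[ℂ] X) (ℬ₀ ℬ₁ : X →ₗ.[ℂ] U) (𝒞₀ 𝒞₁ : 𝒜.domain →ₗ[ℂ] Y)
    (h₀ : BCO.IsSystem 𝒜 ℬ₀ 𝒞₀) (h₁ : BCO.IsSystem 𝒜 ℬ₁ 𝒞₁)
    (hw₀ : BCO.IsWellPosed 𝒜 ℬ₀ 𝒞₀) (hw₁ : BCO.IsWellPosed 𝒜 ℬ₁ 𝒞₁)
    (Q₁₁ : U →L[ℂ] U) (Q₁₂ : Y →L[ℂ] U) (Q₂₁ : U →L[ℂ] Y) (Q₂₂ : Y →L[ℂ] Y)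
    (hQ : ∀ x : 𝒜.domain,
      BCO.blockOperator Q₁₁ Q₁₂ Q₂₁ Q₂₂ (ℬ₀ ⟨x, h₀.domain_le x.2⟩, 𝒞₀ x) =
        (ℬ₁ ⟨x, h₁.domain_le x.2⟩, 𝒞₁ x))
    (hlim : Tendsto (BCO.transferFunction 𝒜 ℬ₀ 𝒞₀) (comap Complex.re atTop) (𝓝 0))
    (hQinv : (BCO.blockOperator Q₁₁ Q₁₂ Q₂₁ Q₂₂).IsInvertible) :
    Q₁₁.IsInvertible := by
  obtain ⟨P, hP⟩ := hQinv
  obtain ⟨m, hm, hest⟩ := hw₁.exists_norm_output_le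
  set G := BCO.transferFunction 𝒜 ℬ₀ 𝒞₀
  -- This lower-bound constant is fixed before `s` is chosen; the `+ 1` keeps it positive even if
  -- `P.symm` is zero.
  set c : ℝ := (‖(P.symm : (U × Y) →L[ℂ] (U × Y))‖ + 1) * (1 + m) with hc
  have hc0 : 0 < c := by positivity
  have hlimR : Tendsto (fun s : ℝ => G s) atTop (𝓝 0) :=
    hlim.comp (tendsto_comap_iff.2 tendsto_id)
  have hsmall : Tendsto (fun s : ℝ => c * (‖Q₁₂‖ * ‖G s‖)) atTop (𝓝 0) := by
    simpa using (hlimR.norm.const_mul ‖Q₁₂‖).const_mul c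
  obtain ⟨s, hs, hG, hex₀, hex₁, hsm⟩ := (hest.and
    ((h₀.eventually_output_eq_transferFunction hw₀).and
    (h₀.eventually_exists_eigenvector.and (h₁.eventually_exists_eigenvector.and
    (hsmall.eventually_lt_const zero_lt_one))))).exists
  have hrel : ∀ x : 𝒜.domain, 𝒜 x = (s : ℂ) • (x : X) →
      ∃ u₀ : U, ((x : X), u₀) ∈ ℬ₀.graph ∧ 𝒞₀ x = G s u₀ ∧
        ((x : X), (Q₁₁ + Q₁₂ ∘L G s) u₀) ∈ ℬ₁.graph ∧
        P (u₀, 𝒞₀ x) = ((Q₁₁ + Q₁₂ ∘L G s) u₀, 𝒞₁ x) := by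
    intro x hx
    have hb := ℬ₀.mem_graph ⟨x, h₀.domain_le x.2⟩
    have hx' := hQ x
    have hGx := hG x _ hx hb
    have h1 : ℬ₁ ⟨x, h₁.domain_le x.2⟩ =
        (Q₁₁ + Q₁₂ ∘L G s) (ℬ₀ ⟨x, h₀.domain_le x.2⟩) := by
      refine (congrArg Prod.fst hx').symm.trans ?_
      rw [hGx]
      rfl
    refine ⟨_, hb, hGx, ?_, ?_⟩
    · rw [← h1]
      exact ℬ₁.mem_graph ⟨x, h₁.domain_le x.2⟩
    · rw [← h1, ← hx', ← hP]
      rfl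
  refine ContinuousLinearMap.isInvertible_of_surjective_add (R := Q₁₂ ∘L G s) hc0 ?_ ?_ ?_
  · intro u₁
    obtain ⟨x, hx, hxu⟩ := hex₁ u₁
    obtain ⟨u₀, -, -, hb, -⟩ := hrel x hx
    exact ⟨u₀, LinearPMap.mem_graph_snd_inj' _ hb hxu rfl⟩
  · intro u
    obtain ⟨x, hx, hxu⟩ := hex₀ u
    obtain ⟨u₀, hb₀, -, hb₁, hPx⟩ := hrel x hx
    obtain rfl : u₀ = u := LinearPMap.mem_graph_snd_inj' _ hb₀ hxu rfl
    set u₁ := (Q₁₁ + Q₁₂ ∘L G s) u₀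
    have hy : ‖𝒞₁ x‖ ≤ m * ‖u₁‖ :=
      hs _ _ _ (BCO.isExponentialSolution_of_eigenvector hx hb₁)
    have hPs : (u₀, 𝒞₀ x) = P.symm (u₁, 𝒞₁ x) := by rw [← hPx, P.symm_apply_apply]
    have hprod : ‖(u₁, 𝒞₁ x)‖ ≤ (1 + m) * ‖u₁‖ := by
      rw [Prod.norm_mk, max_le_iff]
      constructor <;> nlinarith [norm_nonneg u₁]
    calc ‖u₀‖ ≤ ‖(u₀, 𝒞₀ x)‖ := norm_fst_le (u₀, 𝒞₀ x)
      _ ≤ ‖(P.symm : (U × Y) →L[ℂ] (U × Y))‖ * ‖(u₁, 𝒞₁ x)‖ := by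
        rw [hPs]
        exact (P.symm : (U × Y) →L[ℂ] (U × Y)).le_opNorm _
      _ ≤ (‖(P.symm : (U × Y) →L[ℂ] (U × Y))‖ + 1) * ((1 + m) * ‖u₁‖) := by
        gcongr
        linarith
      _ = c * ‖u₁‖ := by rw [hc, mul_assoc]
  · refine lt_of_le_of_lt ?_ hsm
    gcongr
    exact ContinuousLinearMap.opNorm_comp_le _ _
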